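/- Let $R$ be a commutative Noetherian local ring with maximal ideal $\mathfrak{m}$. For an ideal $\mathfrak{a}$ of $R$ and a finitely generated $R$-module $M$, let $\operatorname{depth}_R(\mathfrak{a},M)$ be the common length of the maximal $M$-regular sequences contained in $\mathfrak{a}$ if $\mathfrak{a}M\neq M$, and $\operatorname{depth}_R(\mathfrak{a},M)=\infty$ if $\mathfrak{a}M=M$. An ideal $I$ of $R$ is called Burch if $\mathfrak{m}I\neq\mathfrak{m}(I:_R\mathfrak{m})$. Let $\mathfrak{a}$ be an ideal of $R$ and let $\mathfrak{b}$ be a Burch ideal of $R$. Assume $\operatorname{depth}_R(\mathfrak{a},R)\geq 1$ and $\operatorname{depth}_R(\mathfrak{b},R)\geq 1$. Then $$\operatorname{depth}_R(\mathfrak{a},\mathfrak{b})\leq\operatorname{depth}_R(\mathfrak{a},R)+1 .$$ -/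

import Mathlib

section

variable {R : Type*} [CommRing R]

open Classical in
/-- The `a`-depth (grade of `a` on `M`) of a finitely generated module `M` over a Noetherian ring:
it is `∞` if `a M = M`, and otherwise the greatest length of an `M`-regular sequence in `a`. -/
noncomputable def idealDepth (a : Ideal R) (M : Type*) [AddCommGroup M] [Module R M] : ℕ∞ :=
  if a • (⊤ : Submodule R M) = ⊤ then ⊤
  else ⨆ (rs : List R) (_ : (∀ r ∈ rs, r ∈ a) ∧ RingTheory.Sequence.IsRegular M rs),
    (rs.length : ℕ∞)

/-- An ideal `I` of a local ring with maximal ideal `m` is Burch if `m I ≠ m (I : m)`. -/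
def IsBurch [IsLocalRing R] (I : Ideal R) : Prop :=
  IsLocalRing.maximalIdeal R * I ≠
    IsLocalRing.maximalIdeal R * I.colon (IsLocalRing.maximalIdeal R : Set R)

end

/-! For proper `a`, already depth(a, b) ≤ 1. Choose y ∉ b with my ⊆ b. If r, s in m were b-regular,
then s(ry) = r(sy) ∈ rb would force ry ∈ rb, hence y ∈ b, since r is also regular on R. -/

/-- A Burch ideal is properly contained in its colon by the maximal ideal. -/
theorem IsBurch.exists_mul_mem_notMem {R : Type*} [CommRing R] [IsLocalRing R] {b : Ideal R}
    (hb : IsBurch b) :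
    ∃ y, y ∉ b ∧ ∀ r ∈ IsLocalRing.maximalIdeal R, r * y ∈ b := by
  by_contra! h
  refine hb (congrArg (IsLocalRing.maximalIdeal R * ·) (le_antisymm (fun y hy => ?_) fun y hy => ?_))
  · exact Submodule.mem_colon.mpr fun r _ => b.mul_mem_right r hy
  · by_contra hyb
    obtain ⟨r, hr, hry⟩ := h y hyb
    refine hry ?_
    simpa [mul_comm] using Submodule.mem_colon.mp hy r hr

/-- The colon (0 : m) is killed by m, so both products vanish for the zero ideal. -/
theorem IsBurch.ne_bot {R : Type*} [CommRing R] [IsLocalRing R] {b : Ideal R}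
    (hb : IsBurch b) : b ≠ ⊥ := by
  rintro rfl
  refine hb ?_
  rw [Ideal.mul_bot, eq_comm, eq_bot_iff, Ideal.mul_le]
  intro r hr s hs
  simpa [mul_comm] using Submodule.mem_colon.mp hs r hr

/-- An ideal of positive depth on the ring contains a regular element. -/
theorem exists_mem_isSMulRegular_of_one_le_idealDepth {R : Type*} [CommRing R] {b : Ideal R}
    (hb : 1 ≤ idealDepth b R) : ∃ z ∈ b, IsSMulRegular R z := by
  by_cases hbt : b = ⊤
  · exact ⟨1, hbt ▸ Submodule.mem_top, IsSMulRegular.one R⟩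
  by_contra! h
  have hne : ¬ b • (⊤ : Submodule R R) = ⊤ := by simpa using hbt
  rw [idealDepth, if_neg hne] at hb
  refine absurd (hb.trans (iSup₂_le (a := 0) fun rs hrs => ?_)) (by simp)
  obtain ⟨hmem, hreg⟩ := hrs
  cases rs with
  | nil => simp
  | cons z rs =>
    exact absurd ((RingTheory.Sequence.isWeaklyRegular_cons_iff R z rs).mp
      hreg.toIsWeaklyRegular).1 (h z (hmem z List.mem_cons_self))

/-- An element regular on an ideal that contains a regular element is regular on the ring. -/
theorem IsSMulRegular.of_ideal {R : Type*} [CommRing R] {b : Ideal R} {z r : R} (hzb : z ∈ b)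
    (hz : IsSMulRegular R z) (hr : IsSMulRegular b r) : IsSMulRegular R r := by
  rw [isSMulRegular_iff_right_eq_zero_of_smul] at hz hr ⊢
  intro s hs
  -- Multiplying by z moves s into `b`, where r is regular.
  refine hz s ?_
  have h := hr ⟨z * s, b.mul_mem_right s hzb⟩ (Subtype.ext ?_)
  · exact congrArg Subtype.val h
  · change r * (z * s) = 0
    rw [mul_left_comm, show r * s = 0 from hs, mul_zero]

/-- A Burch ideal containing a regular element has depth at most one. -/
theorem IsBurch.length_le_one {R : Type*} [CommRing R] [IsLocalRing R] {b : Ideal R}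
    (hb : IsBurch b) {z : R} (hzb : z ∈ b) (hz : IsSMulRegular R z) {rs : List R}
    (hmem : ∀ r ∈ rs, r ∈ IsLocalRing.maximalIdeal R)
    (hreg : RingTheory.Sequence.IsWeaklyRegular b rs) : rs.length ≤ 1 := by
  match rs with
  | [] => simp
  | [_] => simp
  | r :: s :: rs =>
    exfalso
    obtain ⟨y, hyb, hy⟩ := hb.exists_mul_mem_notMem
    rw [RingTheory.Sequence.isWeaklyRegular_cons_iff,
      RingTheory.Sequence.isWeaklyRegular_cons_iff] at hreg
    obtain ⟨hr, hs, -⟩ := hreg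
    have hrR := IsSMulRegular.of_ideal hzb hz hr
    rw [isSMulRegular_iff_right_eq_zero_of_smul] at hs
    have h := hs (Submodule.Quotient.mk ⟨r * y, hy r (hmem r (by simp))⟩) (by
      rw [← Submodule.Quotient.mk_smul, Submodule.Quotient.mk_eq_zero,
        Submodule.mem_smul_pointwise_iff_exists]
      refine ⟨⟨s * y, hy s (hmem s (by simp))⟩, trivial, Subtype.ext ?_⟩
      change r * (s * y) = s * (r * y)
      ring)
    rw [Submodule.Quotient.mk_eq_zero, Submodule.mem_smul_pointwise_iff_exists] at h
    obtain ⟨w, -, hw⟩ := h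
    exact hyb (hrR (congrArg Subtype.val hw : r * (w : R) = r * y) ▸ w.2)

theorem corollary3p7 {R : Type*} [CommRing R] [IsLocalRing R] [IsNoetherianRing R]
    (a b : Ideal R) (hb : IsBurch b)
    (ha1 : 1 ≤ idealDepth a R) (hb1 : 1 ≤ idealDepth b R) :
    idealDepth a b ≤ idealDepth a R + 1 := by
  by_cases hat : a = ⊤
  · simp [idealDepth, hat]
  have ham := IsLocalRing.le_maximalIdeal hat
  obtain ⟨z, hzb, hz⟩ := exists_mem_isSMulRegular_of_one_le_idealDepth hb1
  -- Nakayama: b ≠ 0 gives ab ≠ b, so the depth is the supremum.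
  have hne : ¬ a • (⊤ : Submodule R b) = ⊤ := fun h => by
    have htop := Submodule.eq_bot_of_le_smul_of_le_jacobson_bot a (⊤ : Submodule R b)
      (IsNoetherian.noetherian _) h.ge (ham.trans (IsLocalRing.maximalIdeal_le_jacobson ⊥))
    refine hb.ne_bot (eq_bot_iff.mpr fun x hx => ?_)
    have hx0 : (⟨x, hx⟩ : b) ∈ (⊥ : Submodule R b) := htop ▸ Submodule.mem_top
    exact congrArg Subtype.val ((Submodule.mem_bot R).mp hx0)
  rw [idealDepth, if_neg hne]
  refine iSup₂_le fun rs hrs => le_trans ?_ le_add_self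
  exact_mod_cast hb.length_le_one hzb hz (fun r hr => ham (hrs.1 r hr)) hrs.2.toIsWeaklyRegular
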